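/- Assume Martin's Axiom (for every nonempty ccc notion of forcing $\mathbb{P}$ and every family of fewer than $2^\omega$ dense subsets of $\mathbb{P}$ there is a filter on $\mathbb{P}$ meeting every member of the family). For $A\subseteq\mathbb{Q}$ put $L^0(A)=A$ and let $L^{k+1}(A)$ be the set of all $a\in A$ which are limit points of $L^k(A)$. Let $\mathrm{CB}(A)$ be the least $k\in\omega$ with $L^k(A)=\varnothing$ if such a $k$ exists, and write $\mathrm{CB}(A)\geq\omega$ otherwise. Let $\mathcal{I}$ be the collection of all $A\subseteq\mathbb{Q}$ with $\mathrm{CB}(A)<\omega$. A coloring $\chi:[X]^2\to C$ is $2$-bounded if $|\chi^{-1}[\{c\}]|\leq 2$ for every $c\in C$, and a set $Y\subseteq X$ is polychromatic for $\chi$ if $\chi$ is injective on $[Y]^2$. 1. Let $\mathcal{S}$ be a filter base on $\mathbb{Q}$ (a nonempty family of subsets of $\mathbb{Q}$ such that the intersection of any two members includes a member) with $\mathcal{S}\cap\mathcal{I}=\varnothing$ and $|\mathcal{S}|<2^\omega$, and let $\chi:[\mathbb{Q}]^2\to C$ be a $2$-bounded coloring. Then there is a set $B\subseteq\mathbb{Q}$,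 polychromatic for $\chi$, such that $B\cap S\notin\mathcal{I}$ for every $S\in\mathcal{S}$. 2. There is a nonprincipal ultrafilter $\mathcal{U}$ on $\omega$ which is rainbow Ramsey (every $2$-bounded coloring $\chi:[\omega]^2\to\omega$ has a polychromatic set belonging to $\mathcal{U}$) but not discrete (it is not the case that for every $f:\omega\to\mathbb{Q}$ there is $A\in\mathcal{U}$ with $f(A)$ a discrete subset of $\mathbb{Q}$). -/

import Mathlib

open Set Filter Topology
open scoped Cardinal

namespace RainbowRamsey

/-! ### Colorings of `[X]ⁿ` -/

/-- A coloring `χ : [X]ⁿ → C` is `k`-bounded if every color is used at most `k` times. -/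
def IsBoundedColoring {X C : Type*} {n : ℕ} (k : ℕ) (χ : Set.powersetCard X n → C) : Prop :=
  ∀ c : C, (χ ⁻¹' {c}).encard ≤ k

/-- `Y ⊆ X` is polychromatic for `χ : [X]ⁿ → C` if distinct members of `[Y]ⁿ` receive
distinct colors. -/
def IsPolychromatic {X C : Type*} {n : ℕ} (χ : Set.powersetCard X n → C) (Y : Set X) : Prop :=
  Set.InjOn χ {s | ((s : Finset X) : Set X) ⊆ Y}

/-! ### Finite Cantor–Bendixson rank -/

/-- `L⁰(A) = A`, and `Lᵏ⁺¹(A)` is the set of those `a ∈ A` which are limit points of `Lᵏ(A)`. -/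
def cbLevel {X : Type*} [TopologicalSpace X] (A : Set X) : ℕ → Set X
  | 0 => A
  | k + 1 => {a ∈ A | AccPt a (𝓟 (cbLevel A k))}

/-- The least `k` with `Lᵏ(A) = ∅` if there is one, and `⊤` (that is, `CB(A) ≥ ω`) otherwise. -/
noncomputable def cbRank {X : Type*} [TopologicalSpace X] (A : Set X) : ℕ∞ :=
  ⨅ (k : ℕ) (_ : cbLevel A k = ∅), (k : ℕ∞)

/-- The collection of all `A ⊆ ℚ` of finite Cantor–Bendixson rank. -/
def finiteCBRank : Set (Set ℚ) :=
  {A | cbRank A < ⊤}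

theorem mem_finiteCBRank_iff (A : Set ℚ) : A ∈ finiteCBRank ↔ ∃ k : ℕ, cbLevel A k = ∅ := by
  simp [finiteCBRank, cbRank, iInf_lt_iff]

/-! ### Martin's Axiom -/

/-- The countable chain condition for a notion of forcing: every set of pairwise incompatible
conditions is countable. -/
def CountableChainCondition (P : Type*) [Preorder P] : Prop :=
  ∀ A : Set P, A.Pairwise (fun p q => ¬ ∃ r, r ≤ p ∧ r ≤ q) → A.Countable

/-- Martin's Axiom: for every nonempty ccc notion of forcing `P` and every family of fewer than
`2^ω` dense subsets of `P` there is a filter on `P` meeting all members of the family. -/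
def MartinsAxiom : Prop :=
  ∀ (P : Type) [Preorder P] [Nonempty P], CountableChainCondition P →
    ∀ 𝒟 : Set (Set P), #𝒟 < 𝔠 → (∀ D ∈ 𝒟, IsCoinitial D) →
      ∃ G : Order.PFilter P, ∀ D ∈ 𝒟, ((G : Set P) ∩ D).Nonempty

/-! ### Special ultrafilters on `ω` -/

/-- An ultrafilter is nonprincipal if it is not the ultrafilter of all sets containing some
given point. -/
def IsNonprincipal {X : Type*} (U : Ultrafilter X) : Prop :=
  ∀ x : X, U ≠ pure x

/-- A nonprincipal ultrafilter on `ω` is rainbow Ramsey if it contains a polychromatic set for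
every 2-bounded coloring `χ : [ω]² → ω`. -/
def IsRainbowRamsey (U : Ultrafilter ℕ) : Prop :=
  IsNonprincipal U ∧
    ∀ χ : Set.powersetCard ℕ 2 → ℕ, IsBoundedColoring 2 χ → ∃ A ∈ U, IsPolychromatic χ A

/-- A nonprincipal ultrafilter on `ω` is discrete if every `f : ω → ℚ` maps some member of the
ultrafilter onto a discrete subset of `ℚ`. -/
def IsDiscreteUltrafilter (U : Ultrafilter ℕ) : Prop :=
  IsNonprincipal U ∧ ∀ f : ℕ → ℚ, ∃ A ∈ U, IsDiscrete (f '' A)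

end RainbowRamsey

namespace RainbowRamsey

/-! ### Sets of finite Cantor–Bendixson rank -/

section CantorBendixson

variable {X : Type*} [TopologicalSpace X]

/-! Sets of finite rank form an ideal (`cbLevel_union`), so a family whose finite intersections have
infinite rank extends to an ultrafilter `U` of sets of infinite rank. The forcing consists of finite
polychromatic stems that `U`-many points can join, with finitely many promises that a point `z` of
the stem will get rank `k` inside `S`. Such a promise records only a possibility (`Fulfillable`):
for `k > 0`, arbitrarily close to `z` there are points that can be added and promised rank `k - 1`.

Density rests on uniform counting. By 2-boundedness, three vertices of a conflict determine the
fourth, so adding a point to a stem of size `s` obstructs at most `(s + 1) ^ 3` others, apart from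
finitely many exceptions (`encard_obstruction_le`). A bound independent of the added point survives
limits, both towards `z` and along `U`. Hence only finitely many points spoil a condition
(`finite_bad`), while a set of infinite rank always offers a point carrying a new promise
(`exists_fulfillable`). A generic filter keeps all its promises.

For the ultrafilter, this is iterated over the at most `𝔠` colorings. All members of the result have
infinite rank in `ℚ`, whereas discrete sets have finite rank. -/

theorem cbLevel_subset (A : Set X) : ∀ n, cbLevel A n ⊆ A
  | 0 => Subset.rfl
  | _ + 1 => fun _ h => h.1

theorem cbLevel_mono {A B : Set X} (h : A ⊆ B) : ∀ n, cbLevel A n ⊆ cbLevel B n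
  | 0 => h
  | n + 1 => fun _ hx => ⟨h hx.1, hx.2.mono (principal_mono.2 (cbLevel_mono h n))⟩

theorem cbLevel_inter_isOpen {A U : Set X} (hU : IsOpen U) :
    ∀ (n : ℕ) {x : X}, x ∈ cbLevel A n → x ∈ U → x ∈ cbLevel (A ∩ U) n
  | 0, _, hx, hxU => ⟨hx, hxU⟩
  | n + 1, x, hx, hxU => by
    refine ⟨⟨hx.1, hxU⟩, ?_⟩
    rw [accPt_iff_nhds]
    intro V hV
    obtain ⟨y, hy, hne⟩ := accPt_iff_nhds.1 hx.2 _ (inter_mem hV (hU.mem_nhds hxU))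
    exact ⟨y, ⟨hy.1.1, cbLevel_inter_isOpen hU n hy.2 hy.1.2⟩, hne⟩

/-- A point which is not an accumulation point of `C`, but is one of `D`, has arbitrarily small
punctured neighbourhoods that avoid `C` and meet `D`. -/
theorem exists_isOpen_of_not_accPt [T1Space X] {x : X} {C D : Set X}
    (hC : ¬ AccPt x (𝓟 C)) (hD : AccPt x (𝓟 D)) :
    ∃ V : Set X, IsOpen V ∧ x ∉ V ∧ Disjoint V C ∧ (V ∩ D).Nonempty := by
  rw [accPt_iff_nhds] at hC
  push Not at hC
  obtain ⟨W, hW, hWC⟩ := hC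
  obtain ⟨V, hVW, hV, hxV⟩ := mem_nhds_iff.1 hW
  obtain ⟨y, hy, hne⟩ := accPt_iff_nhds.1 hD V (hV.mem_nhds hxV)
  refine ⟨V \ {x}, hV.sdiff isClosed_singleton, by simp, ?_, y, ⟨hy.1, hne⟩, hy.2⟩
  rw [Set.disjoint_left]
  exact fun z hz hzC => hz.2 (hWC z ⟨hVW hz.1, hzC⟩)

/-- If a top-level point of `A` is not a limit of `cbLevel A k`, some open set near it misses that
level but still meets level `n` of the union. Inside it `A` cannot reach level `k`, so by induction
`B` must reach level `m`. -/
theorem cbLevel_union [T1Space X] (n : ℕ) : ∀ (k m : ℕ), k + m = n → ∀ A B : Set X,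
    (cbLevel (A ∪ B) n).Nonempty → (cbLevel A k).Nonempty ∨ (cbLevel B m).Nonempty := by
  induction n with
  | zero =>
    intro k m h A B ⟨x, hx⟩
    obtain ⟨rfl, rfl⟩ : k = 0 ∧ m = 0 := by omega
    exact hx.imp (fun h => ⟨x, h⟩) (fun h => ⟨x, h⟩)
  | succ n ih =>
    have key : ∀ (k m : ℕ), k + m = n + 1 → ∀ A B : Set X, ∀ x ∈ A, x ∈ cbLevel (A ∪ B) (n + 1) →
        (cbLevel A k).Nonempty ∨ (cbLevel B m).Nonempty := by
      intro k m h A B x hxA hx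
      rcases k with _ | k
      · exact Or.inl ⟨x, hxA⟩
      by_cases hacc : AccPt x (𝓟 (cbLevel A k))
      · exact Or.inl ⟨x, hxA, hacc⟩
      · obtain ⟨V, hV, -, hdisj, y, hyV, hy⟩ := exists_isOpen_of_not_accPt hacc hx.2
        have hy' := cbLevel_inter_isOpen hV n hy hyV
        rw [union_inter_distrib_right] at hy'
        rcases ih k m (by omega) _ _ ⟨y, hy'⟩ with ⟨z, hz⟩ | ⟨z, hz⟩
        · exact absurd (cbLevel_mono inter_subset_left _ hz)
            (Set.disjoint_left.1 hdisj (cbLevel_subset _ _ hz).2)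
        · exact Or.inr ⟨z, cbLevel_mono inter_subset_left _ hz⟩
    intro k m h A B ⟨x, hx⟩
    rcases hx.1 with hxA | hxB
    · exact key k m h A B x hxA hx
    · rw [union_comm] at hx
      exact (key m k (by omega) B A x hxB hx).symm

/-- If every point of `T` lies in at most `j` of the sets `G z`, then a set `T` of large rank has a
point `z` around which `T \ G z` still has large rank. -/
theorem exists_accPt_cbLevel_diff [T1Space X] (m : ℕ) : ∀ j : ℕ, ∃ n : ℕ,
    ∀ (G : X → Set X) (T : Set X), (∀ y ∈ T, {z ∈ T | y ∈ G z}.encard ≤ j) → (cbLevel T n).Nonempty →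
      ∃ z ∈ T, AccPt z (𝓟 (cbLevel (T \ G z) m)) := by
  intro j
  induction j with
  | zero =>
    refine ⟨m + 1, fun G T hT ⟨x, hx⟩ => ⟨x, hx.1, ?_⟩⟩
    have h : T \ G x = T := by
      refine sdiff_eq_left.2 (Set.disjoint_left.2 fun y hy hyG => ?_)
      have h0 : ∀ z ∈ T, y ∉ G z := by simpa using hT y hy
      exact h0 x hx.1 hyG
    rw [h]
    exact hx.2
  | succ j ih =>
    obtain ⟨n, hn⟩ := ih
    -- One level is spent on passing to a punctured neighbourhood `V` of `x`, and `m + n` are split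
    -- between `T \ G x` and `T ∩ G x`.
    refine ⟨m + n + 1, fun G T hT ⟨x, hx⟩ => ?_⟩
    by_cases hacc : AccPt x (𝓟 (cbLevel (T \ G x) m))
    · exact ⟨x, hx.1, hacc⟩
    obtain ⟨V, hV, hxV, hdisj, y, hyV, hy⟩ := exists_isOpen_of_not_accPt hacc hx.2
    have hy' := cbLevel_inter_isOpen hV _ hy hyV
    rw [← sdiff_union_inter T (G x), union_inter_distrib_right] at hy'
    rcases cbLevel_union _ m n rfl _ _ ⟨y, hy'⟩ with ⟨z, hz⟩ | hne
    · exact absurd (cbLevel_mono inter_subset_left _ hz)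
        (Set.disjoint_left.1 hdisj (cbLevel_subset _ _ hz).2)
    have hsub : T ∩ G x ∩ V ⊆ T := fun _ h => h.1.1
    -- The points of this piece all lie in `G x` and `x` itself is outside `V`, so dropping `x`
    -- lowers the multiplicity by one.
    have hcount : ∀ y ∈ T ∩ G x ∩ V, {z ∈ T ∩ G x ∩ V | y ∈ G z}.encard ≤ j := by
      intro y hy
      have hx' : x ∉ {z ∈ T ∩ G x ∩ V | y ∈ G z} := fun h => hxV h.1.2
      have h1 : (insert x {z ∈ T ∩ G x ∩ V | y ∈ G z}).encard ≤ (j + 1 : ℕ) := by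
        refine le_trans (Set.encard_le_encard ?_) (hT y (hsub hy))
        rintro z (rfl | hz)
        · exact ⟨hx.1, hy.1.2⟩
        · exact ⟨hsub hz.1, hz.2⟩
      rw [Set.encard_insert_of_notMem hx', Nat.cast_add, Nat.cast_one] at h1
      exact (ENat.add_le_add_iff_right ENat.one_ne_top).1 h1
    obtain ⟨z, hz, hzacc⟩ := hn G _ hcount hne
    exact ⟨z, hsub hz, hzacc.mono (principal_mono.2
      (cbLevel_mono (sdiff_subset_sdiff_left hsub) _))⟩

theorem cbLevel_eq_empty_of_isDiscrete {A : Set X} (hA : IsDiscrete A) : cbLevel A 1 = ∅ := by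
  refine Set.eq_empty_of_forall_notMem fun x hx => ?_
  have h := (isDiscrete_iff_nhdsWithin.1 hA) x hx.1
  have h2 := accPt_iff_frequently_nhdsNE.1 hx.2
  refine h2 ?_
  have h3 : ({x} : Set X) ∈ 𝓝[A] x := h ▸ mem_pure.2 rfl
  rw [mem_nhdsWithin_iff_eventually] at h3
  rw [eventually_nhdsWithin_iff]
  filter_upwards [h3] with y hy hne hyA using hne (hy hyA)

theorem cbLevel_univ [∀ x : X, (𝓝[≠] x).NeBot] (n : ℕ) : cbLevel (univ : Set X) n = univ := by
  induction n with
  | zero => rfl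
  | succ n ih =>
    refine eq_univ_of_forall fun x => ⟨mem_univ x, ?_⟩
    rw [ih, principal_univ, AccPt, inf_top_eq]
    infer_instance

end CantorBendixson

theorem finiteCBRank_mono {A B : Set ℚ} (h : A ⊆ B) (hB : B ∈ finiteCBRank) :
    A ∈ finiteCBRank := by
  rw [mem_finiteCBRank_iff] at *
  obtain ⟨k, hk⟩ := hB
  exact ⟨k, Set.subset_empty_iff.1 (hk ▸ cbLevel_mono h k)⟩

theorem finiteCBRank_union {A B : Set ℚ} (hA : A ∈ finiteCBRank) (hB : B ∈ finiteCBRank) :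
    A ∪ B ∈ finiteCBRank := by
  rw [mem_finiteCBRank_iff] at *
  obtain ⟨k, hk⟩ := hA
  obtain ⟨m, hm⟩ := hB
  refine ⟨k + m, Set.not_nonempty_iff_eq_empty.1 fun h => ?_⟩
  rcases cbLevel_union _ k m rfl _ _ h with h | h
  · exact (hk ▸ h).ne_empty rfl
  · exact (hm ▸ h).ne_empty rfl

theorem finiteCBRank_of_isDiscrete {A : Set ℚ} (hA : IsDiscrete A) : A ∈ finiteCBRank :=
  (mem_finiteCBRank_iff A).2 ⟨1, cbLevel_eq_empty_of_isDiscrete hA⟩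

theorem finiteCBRank_of_finite {A : Set ℚ} (hA : A.Finite) : A ∈ finiteCBRank :=
  finiteCBRank_of_isDiscrete hA.isDiscrete

theorem univ_notMem_finiteCBRank : (univ : Set ℚ) ∉ finiteCBRank := by
  rw [mem_finiteCBRank_iff]
  rintro ⟨k, hk⟩
  rw [cbLevel_univ] at hk
  exact univ_nonempty.ne_empty hk

/-! ### Conflicts of a 2-bounded coloring of pairs -/

section Conflict

variable {X C : Type*} [DecidableEq X] {χ : Set.powersetCard X 2 → C}

/-- `{a, b}` and `{c, d}` are different pairs of the same color. -/
def Conflict (χ : Set.powersetCard X 2 → C) (a b c d : X) : Prop :=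
  ∃ e e' : Set.powersetCard X 2, e.1 = {a, b} ∧ e'.1 = {c, d} ∧ e ≠ e' ∧ χ e = χ e'

theorem Conflict.swap_left {a b c d : X} (h : Conflict χ a b c d) : Conflict χ b a c d := by
  obtain ⟨e, e', h1, h2, h3, h4⟩ := h
  exact ⟨e, e', by rw [h1, Finset.pair_comm], h2, h3, h4⟩

theorem Conflict.symm {a b c d : X} (h : Conflict χ a b c d) : Conflict χ c d a b := by
  obtain ⟨e, e', h1, h2, h3, h4⟩ := h
  exact ⟨e', e, h2, h1, h3.symm, h4.symm⟩

theorem Conflict.ne_left {a b c d : X} (h : Conflict χ a b c d) : a ≠ b := by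
  obtain ⟨e, e', h1, -⟩ := h
  rintro rfl
  have : e.1.card = 2 := e.2
  simp [h1] at this

theorem not_conflict_self (a b : X) : ¬ Conflict χ a b a b := by
  rintro ⟨e, e', h1, h2, h3, -⟩
  exact h3 (Subtype.ext (h1.trans h2.symm))

/-- The color class of `{c, d}` has room for just one other pair, and that pair with `b` removed
leaves `z`. -/
theorem Conflict.unique (hχ : IsBoundedColoring 2 χ) {z z' b c d : X} (h : Conflict χ z b c d)
    (h' : Conflict χ z' b c d) : z = z' := by
  have hzb := h.ne_left
  obtain ⟨e₁, e, h1, h2, h3, h4⟩ := h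
  obtain ⟨e₂, e', h1', h2', h3', h4'⟩ := h'
  obtain rfl : e = e' := Subtype.ext (h2.trans h2'.symm)
  have h12 : e₁ = e₂ := by
    by_contra hne
    have hsub : ({e₁, e₂, e} : Set (Set.powersetCard X 2)) ⊆ χ ⁻¹' {χ e} := by
      rintro x (rfl | rfl | rfl)
      exacts [h4, h4', rfl]
    have h5 := (Set.encard_le_encard hsub).trans (hχ (χ e))
    rw [Set.encard_insert_of_notMem (by simp [hne, h3]), Set.encard_pair h3'] at h5
    exact absurd h5 (by decide)
  have h6 : z ∈ ({z', b} : Finset X) := by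
    rw [← h1', ← h12, h1]
    simp
  simpa [hzb] using h6

theorem isPolychromatic_iff {Y : Set X} : IsPolychromatic χ Y ↔
    ∀ a ∈ Y, ∀ b ∈ Y, ∀ c ∈ Y, ∀ d ∈ Y, ¬ Conflict χ a b c d := by
  constructor
  · rintro h a ha b hb c hc d hd ⟨e, e', h1, h2, h3, h4⟩
    refine h3 (h ?_ ?_ h4)
    · change (e.1 : Set X) ⊆ Y
      simp [h1, Set.insert_subset_iff, ha, hb]
    · change (e'.1 : Set X) ⊆ Y
      simp [h2, Set.insert_subset_iff, hc, hd]
  · intro h e he e' he' hc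
    by_contra hne
    obtain ⟨a, b, -, hab⟩ := Finset.card_eq_two.1 e.2
    obtain ⟨c, d, -, hcd⟩ := Finset.card_eq_two.1 e'.2
    replace he : (e.1 : Set X) ⊆ Y := he
    replace he' : (e'.1 : Set X) ⊆ Y := he'
    rw [hab] at he
    rw [hcd] at he'
    exact h a (he (by simp)) b (he (by simp)) c (he' (by simp)) d (he' (by simp))
      ⟨e, e', hab, hcd, hne, hc⟩

/-- The points `y` at which `z` conflicts with itself relative to `F`. -/
theorem finite_conflict_self (hχ : IsBoundedColoring 2 χ) (F : Finset X) (z : X) :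
    {y | ∃ a ∈ F, Conflict χ z y z a}.Finite := by
  have : {y | ∃ a ∈ F, Conflict χ z y z a} = ⋃ a ∈ F, {y | Conflict χ z y z a} := by
    ext
    simp
  rw [this]
  refine F.finite_toSet.biUnion fun a _ => Set.Subsingleton.finite fun y hy y' hy' => ?_
  exact Conflict.unique hχ (Conflict.swap_left hy) (Conflict.swap_left hy')

/-- The points `z` that may be added to `F`, but not to `F ∪ {y}`, for a reason other than a
conflict between two pairs that both contain `z`. -/
def obstruction (χ : Set.powersetCard X 2 → C) (F : Finset X) (y : X) : Set X :=
  {z | ¬ IsPolychromatic χ (insert z (insert y F) : Finset X) ∧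
    IsPolychromatic χ (insert z F : Finset X) ∧ ∀ a ∈ F, ¬ Conflict χ z y z a}

/-- Some conflict must use `z`. It cannot use `z` in both pairs: if `y` is involved this is the
third clause of `obstruction`, otherwise the second. -/
theorem exists_conflict_of_mem_obstruction {F : Finset X} {y z : X}
    (hy : IsPolychromatic χ (insert y F : Finset X)) (hz : z ∈ obstruction χ F y) :
    ∃ b ∈ insert y F, ∃ c ∈ insert y F, ∃ d ∈ insert y F, Conflict χ z b c d := by
  obtain ⟨h1, h2, h3⟩ := hz
  simp only [isPolychromatic_iff, Finset.mem_coe] at h1 h2 hy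
  push Not at h1
  have key2 : ∀ b ∈ insert z (insert y F), ∀ d ∈ insert z (insert y F), ¬ Conflict χ z b z d := by
    intro b hb d hd hc
    rw [Finset.mem_insert, or_iff_right hc.ne_left.symm] at hb
    rw [Finset.mem_insert, or_iff_right hc.symm.ne_left.symm] at hd
    rcases Finset.mem_insert.1 hb with rfl | hb' <;> rcases Finset.mem_insert.1 hd with rfl | hd'
    · exact not_conflict_self _ _ hc
    · exact h3 d hd' hc
    · exact h3 b hb' hc.symm
    · exact h2 z (by simp) b (by simp [hb']) z (by simp) d (by simp [hd']) hc
  have key : ∀ b ∈ insert z (insert y F), ∀ c ∈ insert z (insert y F),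
      ∀ d ∈ insert z (insert y F), Conflict χ z b c d →
      ∃ b ∈ insert y F, ∃ c ∈ insert y F, ∃ d ∈ insert y F, Conflict χ z b c d := by
    intro b hb c hc d hd h
    rcases Finset.mem_insert.1 hc with rfl | hc'
    · exact absurd h (key2 b hb d hd)
    rcases Finset.mem_insert.1 hd with rfl | hd'
    · exact absurd h.symm.swap_left.symm (key2 b hb c hc)
    exact ⟨b, (Finset.mem_insert.1 hb).resolve_left h.ne_left.symm, c, hc', d, hd', h⟩
  obtain ⟨a, ha, b, hb, c, hc, d, hd, h⟩ := h1
  rcases Finset.mem_insert.1 ha with rfl | ha'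
  · exact key b hb c hc d hd h
  rcases Finset.mem_insert.1 hb with rfl | hb'
  · exact key a ha c hc d hd h.swap_left
  rcases Finset.mem_insert.1 hc with rfl | hc'
  · exact key d hd a ha b hb h.symm
  rcases Finset.mem_insert.1 hd with rfl | hd'
  · exact key c hc a ha b hb h.symm.swap_left
  exact absurd h (hy a ha' b hb' c hc' d hd')

/-- The triple `(b, c, d)` of remaining vertices determines `z`. The bound does not depend on `y`.
-/
theorem encard_obstruction_le (hχ : IsBoundedColoring 2 χ) {F : Finset X} {y : X} {s : ℕ}
    (hs : F.card ≤ s) (hy : IsPolychromatic χ (insert y F : Finset X)) :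
    (obstruction χ F y).encard ≤ ((s + 1) ^ 3 : ℕ) := by
  have h := fun z (hz : z ∈ obstruction χ F y) => exists_conflict_of_mem_obstruction hy hz
  choose! b hb c hc d hd hconf using h
  let P : Finset (X × X × X) := insert y F ×ˢ insert y F ×ˢ insert y F
  have hle : (obstruction χ F y).encard ≤ (P : Set (X × X × X)).encard := by
    refine Set.encard_le_encard_of_injOn (f := fun z => (b z, c z, d z)) (fun z hz => ?_) ?_
    · simp only [P, Finset.mem_coe, Finset.mem_product]
      exact ⟨hb z hz, hc z hz, hd z hz⟩
    · intro z hz z' hz' he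
      simp only [Prod.mk.injEq] at he
      obtain ⟨h1, h2, h3⟩ := he
      have := hconf z hz
      rw [h1, h2, h3] at this
      exact this.unique hχ (hconf z' hz')
  refine hle.trans ?_
  rw [Set.encard_coe_eq_coe_finsetCard, Nat.cast_le]
  simp only [P, Finset.card_product]
  have : (insert y F).card ≤ s + 1 := (Finset.card_insert_le _ _).trans (by omega)
  calc _ ≤ (s + 1) * ((s + 1) * (s + 1)) := by gcongr
    _ = _ := by ring

end Conflict

theorem eventually_notMem_nhdsNE {X : Type*} [TopologicalSpace X] [T1Space X] {A : Set X} (hA : A.Finite) (z : X) :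
    ∀ᶠ w in 𝓝[≠] z, w ∉ A := by
  have h : (A \ {z})ᶜ ∈ 𝓝 z :=
    (hA.subset sdiff_subset).isClosed.isOpen_compl.mem_nhds (by simp)
  rw [eventually_nhdsWithin_iff]
  filter_upwards [h] with w hw hne hwA using hw ⟨hwA, hne⟩

/-- If each point of `A` lies in `H w` for almost all `w`, and almost all `H w` have at most `N`
points, then so does `A`. -/
theorem encard_le_of_eventually {X Y : Type*} {l : Filter X} [l.NeBot] {H : X → Set Y} {A : Set Y}
    {N : ℕ} (hA : ∀ y ∈ A, ∀ᶠ w in l, y ∈ H w) (hH : ∀ᶠ w in l, (H w).encard ≤ N) :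
    A.encard ≤ N := by
  by_contra hlt
  rw [not_le] at hlt
  obtain ⟨t, htA, ht⟩ := Set.exists_subset_encard_eq (Order.add_one_le_of_lt hlt)
  have hfin : t.Finite := Set.finite_of_encard_eq_coe (k := N + 1) (by simpa using ht)
  have hev : ∀ᶠ w in l, ∀ y ∈ t, y ∈ H w :=
    (Filter.eventually_all_finite hfin).2 fun y hy => hA y (htA hy)
  obtain ⟨w, hw, hwN⟩ := (hev.and hH).exists
  have := (Set.encard_le_encard (show t ⊆ H w from hw)).trans hwN
  rw [ht] at this
  exact absurd this (by exact_mod_cast Nat.not_succ_le_self N)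

/-! ### Promises -/

section Promise

variable {X C : Type*} [DecidableEq X] [TopologicalSpace X] {χ : Set.powersetCard X 2 → C}

/-- The finite polychromatic set `F ∋ z` can be extended, one point at a time, by points of `S` so
that `z` gets rank `k`: stepwise, there are points arbitrarily close to the last one which can be
added next. -/
def Fulfillable (χ : Set.powersetCard X 2 → C) (S : Set X) : ℕ → Finset X → X → Prop
  | 0, F, z => z ∈ S ∧ z ∈ F ∧ IsPolychromatic χ (F : Set X)
  | k + 1, F, z => (z ∈ S ∧ z ∈ F ∧ IsPolychromatic χ (F : Set X)) ∧
      AccPt z (𝓟 {w | Fulfillable χ S k (insert w F) w})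

theorem Fulfillable.basic {S : Set X} : ∀ {k : ℕ} {F : Finset X} {z : X},
    Fulfillable χ S k F z → z ∈ S ∧ z ∈ F ∧ IsPolychromatic χ (F : Set X)
  | 0, _, _, h => h
  | _ + 1, _, _, h => h.1

/-- Adding a point destroys a promise for boundedly many points only. -/
theorem exists_encard_not_fulfillable_le [T1Space X] (hχ : IsBoundedColoring 2 χ) (S : Set X)
    (k : ℕ) : ∀ s : ℕ, ∃ N : ℕ, ∀ (F : Finset X) (z : X), F.card ≤ s → Fulfillable χ S k F z →
      {y | IsPolychromatic χ (insert y F : Finset X) ∧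
        ¬ Fulfillable χ S k (insert y F) z}.encard ≤ N := by
  induction k with
  | zero =>
    refine fun s => ⟨0, fun F z _ h => ?_⟩
    rw [Nat.cast_zero, nonpos_iff_eq_zero, Set.encard_eq_zero]
    refine Set.eq_empty_of_forall_notMem fun y hy => hy.2 ⟨h.1, ?_, hy.1⟩
    simp [h.2.1]
  | succ k ih =>
    intro s
    obtain ⟨N, hN⟩ := ih (s + 1)
    -- For most witnesses `w` near `z`, a harmful `y` either obstructs or is obstructed by `w`, or
    -- destroys the rank `k` promise at `w`. The two summands bound these cases for each `w`.
    refine ⟨(s + 1) ^ 3 + N, fun F z hF h => ?_⟩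
    have hne : (𝓝[≠] z ⊓ 𝓟 {w | Fulfillable χ S k (insert w F) w}).NeBot := h.2
    have hmem : ∀ᶠ w in 𝓝[≠] z ⊓ 𝓟 {w | Fulfillable χ S k (insert w F) w},
        Fulfillable χ S k (insert w F) w := eventually_inf_principal.2 (by simp)
    refine encard_le_of_eventually (l := 𝓝[≠] z ⊓ 𝓟 {w | Fulfillable χ S k (insert w F) w})
      (H := fun w => obstruction χ F w ∪
        {y | IsPolychromatic χ (insert y (insert w F) : Finset X) ∧
          ¬ Fulfillable χ S k (insert y (insert w F)) w}) ?_ ?_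
    · rintro y ⟨hy, hyn⟩
      have hacc : ¬ AccPt z (𝓟 {w | Fulfillable χ S k (insert w (insert y F)) w}) :=
        fun hacc => hyn ⟨⟨h.basic.1, by simp [h.basic.2.1], hy⟩, hacc⟩
      rw [accPt_iff_frequently_nhdsNE, not_frequently] at hacc
      have hfin := eventually_notMem_nhdsNE (finite_conflict_self hχ F y) z
      filter_upwards [hmem, hacc.filter_mono inf_le_left, hfin.filter_mono inf_le_left]
        with w hw hwn hwc
      by_cases hp : IsPolychromatic χ (insert y (insert w F) : Finset X)
      · refine Or.inr ⟨hp, ?_⟩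
        rw [Finset.insert_comm]
        exact hwn
      · exact Or.inl ⟨hp, hy, fun a ha hc => hwc ⟨a, ha, hc⟩⟩
    · filter_upwards [hmem] with w hw
      rw [Nat.cast_add]
      refine (Set.encard_union_le _ _).trans (add_le_add ?_ ?_)
      · exact encard_obstruction_le hχ hF hw.basic.2.2
      · exact hN _ _ ((Finset.card_insert_le _ _).trans (by omega)) hw

/-- Sets of large rank contain points that can be added together with a new promise. -/
theorem exists_fulfillable [T1Space X] (hχ : IsBoundedColoring 2 χ) (S : Set X) (k : ℕ) :
    ∀ s : ℕ, ∃ n : ℕ, ∀ F : Finset X, F.card ≤ s → ∀ T ⊆ S,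
      (∀ y ∈ T, IsPolychromatic χ (insert y F : Finset X)) → (cbLevel T n).Nonempty →
        ∃ z ∈ T, Fulfillable χ S k (insert z F) z := by
  induction k with
  | zero =>
    refine fun s => ⟨0, fun F _ T hTS hT ⟨z, hz⟩ => ⟨z, hz, hTS hz, by simp, hT z hz⟩⟩
  | succ k ih =>
    intro s
    obtain ⟨m, hm⟩ := ih (s + 1)
    obtain ⟨n, hn⟩ := exists_accPt_cbLevel_diff (X := X) m ((s + 1) ^ 3)
    refine ⟨n, fun F hF T hTS hT hne => ?_⟩
    -- Reading the obstruction relation backwards turns its bound into a bound on how many sets `G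
    -- z` contain a given `y`.
    obtain ⟨z, hz, hacc⟩ := hn (fun z => {y | z ∈ obstruction χ F y}) T (fun y hy =>
      (Set.encard_le_encard fun _ h => h.2).trans (encard_obstruction_le hχ hF (hT y hy))) hne
    refine ⟨z, hz, ⟨hTS hz, by simp, hT z hz⟩, ?_⟩
    rw [accPt_iff_nhds]
    intro W hW
    have hE := finite_conflict_self hχ F z
    obtain ⟨V, hVW, hV, hzV⟩ := mem_nhds_iff.1 hW
    -- The finite exceptional set is removed without `z`, so that this is still a neighbourhood of
    -- `z`; `z` itself is deleted afterwards.
    have hV' : IsOpen (V \ ({y | ∃ a ∈ F, Conflict χ z y z a} \ {z})) :=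
      hV.sdiff (hE.subset sdiff_subset).isClosed
    obtain ⟨y, hy, hyz⟩ := accPt_iff_nhds.1 hacc _ (hV'.mem_nhds ⟨hzV, by simp⟩)
    have hV'' := hV'.sdiff (isClosed_singleton (x := z))
    have hy' := cbLevel_inter_isOpen hV'' m hy.2 ⟨hy.1, hyz⟩
    have hp : ∀ x ∈ (T \ {y | z ∈ obstruction χ F y}) ∩
        ((V \ ({y | ∃ a ∈ F, Conflict χ z y z a} \ {z})) \ {z}),
        IsPolychromatic χ (insert x (insert z F) : Finset X) := by
      intro x hx
      by_contra hp
      rw [Finset.insert_comm] at hp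
      exact hx.1.2 ⟨hp, hT z hz, fun a ha hc => hx.2.1.2 ⟨⟨a, ha, hc⟩, hx.2.2⟩⟩
    obtain ⟨w, hw, hwf⟩ := hm (insert z F) ((Finset.card_insert_le _ _).trans (by omega)) _
      (fun x hx => hTS hx.1.1) hp ⟨y, hy'⟩
    exact ⟨w, ⟨hVW hw.2.1.1, hwf⟩, hw.2.2⟩

end Promise

/-! ### Ultrafilters of sets of infinite rank -/

/-- A family of sets of rationals is positive if its finite intersections have infinite rank. -/
def IsPositiveFamily (𝒜 : Set (Set ℚ)) : Prop :=
  ∀ t ⊆ 𝒜, t.Finite → ⋂₀ t ∉ finiteCBRank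

/-- Positivity says exactly that the filter generated by `𝒜` and the complements of sets of finite
rank is proper. -/
theorem IsPositiveFamily.exists_ultrafilter {𝒜 : Set (Set ℚ)} (h : IsPositiveFamily 𝒜) :
    ∃ U : Ultrafilter ℚ, (∀ A ∈ 𝒜, A ∈ U) ∧ ∀ A ∈ U, A ∉ finiteCBRank := by
  let l : Filter ℚ :=
    { sets := {A | ∃ t ⊆ 𝒜, t.Finite ∧ ⋂₀ t \ A ∈ finiteCBRank}
      univ_sets := ⟨∅, empty_subset _, Set.finite_empty,
        finiteCBRank_of_finite (by simp)⟩
      sets_of_superset := by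
        rintro A B ⟨t, ht, hfin, hA⟩ hAB
        exact ⟨t, ht, hfin, finiteCBRank_mono (sdiff_subset_sdiff_right hAB) hA⟩
      inter_sets := by
        rintro A B ⟨t, ht, hfin, hA⟩ ⟨t', ht', hfin', hB⟩
        refine ⟨t ∪ t', union_subset ht ht', hfin.union hfin',
          finiteCBRank_mono ?_ (finiteCBRank_union hA hB)⟩
        rw [sInter_union]
        rintro x ⟨⟨hx, hx'⟩, hn⟩
        by_cases hxA : x ∈ A
        · exact Or.inr ⟨hx', fun hxB => hn ⟨hxA, hxB⟩⟩
        · exact Or.inl ⟨hx, hxA⟩ }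
  have hl : l.NeBot := by
    refine ⟨fun hbot => ?_⟩
    have : (∅ : Set ℚ) ∈ l := hbot ▸ mem_bot
    obtain ⟨t, ht, hfin, hA⟩ := this
    exact h t ht hfin (by simpa using hA)
  refine ⟨Ultrafilter.of l, fun A hA => Ultrafilter.of_le l ?_, fun A hA hI => ?_⟩
  · exact ⟨{A}, by simpa using hA, Set.finite_singleton A, finiteCBRank_of_finite (by simp)⟩
  · have : Aᶜ ∈ l := ⟨∅, empty_subset _, Set.finite_empty, by simpa using hI⟩
    exact Ultrafilter.compl_notMem_iff.2 hA (Ultrafilter.of_le l this)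

theorem isPositiveFamily_filterBasis {S : FilterBasis ℚ} (hS : S.sets ∩ finiteCBRank = ∅) :
    IsPositiveFamily S.sets := by
  intro t ht hfin hI
  have hmem : ⋂₀ t ∈ S.filter :=
    (sInter_mem hfin).2 fun A hA => (FilterBasis.mem_filter_iff S).2 ⟨A, ht hA, Subset.rfl⟩
  obtain ⟨A, hA, hAt⟩ := (FilterBasis.mem_filter_iff S).1 hmem
  exact (hS ▸ (⟨hA, finiteCBRank_mono hAt hI⟩ : A ∈ S.sets ∩ finiteCBRank) : A ∈ (∅ : Set _))

/-! ### The notion of forcing -/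

section Forcing

variable {C : Type*} {χ : Set.powersetCard ℚ 2 → C} {U : Ultrafilter ℚ}

/-- A finite polychromatic set with room for `U`-many further points, together with finitely many
fulfillable promises `(z, S, k)`. -/
structure Condition (χ : Set.powersetCard ℚ 2 → C) (U : Ultrafilter ℚ) where
  stem : Finset ℚ
  promises : Set (ℚ × Set ℚ × ℕ)
  finite_promises : promises.Finite
  poly : IsPolychromatic χ (stem : Set ℚ)
  room : {y | IsPolychromatic χ (insert y stem : Finset ℚ)} ∈ U
  fulfillable : ∀ φ ∈ promises, Fulfillable χ φ.2.1 φ.2.2 stem φ.1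

instance : Preorder (Condition χ U) where
  le p q := q.stem ⊆ p.stem ∧ q.promises ⊆ p.promises
  le_refl _ := ⟨subset_rfl, subset_rfl⟩
  le_trans _ _ _ h h' := ⟨h'.1.trans h.1, h'.2.trans h.2⟩

theorem isPolychromatic_of_encard_le_one {Y : Set ℚ} (hY : Y.encard ≤ 1) :
    IsPolychromatic χ Y := by
  rw [isPolychromatic_iff]
  intro a ha b hb c _ d _ h
  exact h.ne_left (Set.encard_le_one_iff.1 hY a b ha hb)

instance : Nonempty (Condition χ U) :=
  ⟨{ stem := ∅
     promises := ∅
     finite_promises := Set.finite_empty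
     poly := isPolychromatic_of_encard_le_one (by simp)
     room := by
      refine Filter.mem_of_superset Filter.univ_mem fun y _ => ?_
      exact isPolychromatic_of_encard_le_one (by simp)
     fulfillable := by simp }⟩

/-- There are countably many stems, and two conditions with the same stem are compatible: their
promises can be united, since each depends on the stem alone. -/
theorem countableChainCondition_condition : CountableChainCondition (Condition χ U) := by
  intro A hA
  refine Set.countable_of_injective_of_countable_image (f := Condition.stem) (fun p hp q hq h => ?_)
    (Set.to_countable _)
  by_contra hne
  refine hA hp hq hne ⟨{ p with
    promises := p.promises ∪ q.promises
    finite_promises := p.finite_promises.union q.finite_promises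
    fulfillable := ?_ }, ⟨subset_rfl, subset_union_left⟩, ⟨h.symm.subset, subset_union_right⟩⟩
  rintro φ (hφ | hφ)
  · exact p.fulfillable φ hφ
  · exact h ▸ q.fulfillable φ hφ

namespace Condition

/-- The points that cannot be added to `p`, though they do not conflict with its stem. -/
def bad (p : Condition χ U) : Set ℚ :=
  {w | IsPolychromatic χ (insert w p.stem : Finset ℚ) ∧
    {y | IsPolychromatic χ (insert y (insert w p.stem) : Finset ℚ)} ∉ U} ∪
  ⋃ φ ∈ p.promises, {w | IsPolychromatic χ (insert w p.stem : Finset ℚ) ∧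
    ¬ Fulfillable χ φ.2.1 φ.2.2 (insert w p.stem) φ.1}

/-- A point leaving too little room is obstructed by `U`-almost every `y`, so the bound for a single
`y` passes to the set of all such points. The promises are finitely many, each spoiled by boundedly
many points. -/
theorem finite_bad (hχ : IsBoundedColoring 2 χ) (hU : ∀ A ∈ U, A ∉ finiteCBRank)
    (p : Condition χ U) : p.bad.Finite := by
  refine Set.Finite.union ?_ (p.finite_promises.biUnion fun φ hφ => ?_)
  · refine Set.finite_of_encard_le_coe (k := (p.stem.card + 1) ^ 3) ?_
    refine encard_le_of_eventually (l := (U : Filter ℚ)) (H := obstruction χ p.stem) ?_ ?_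
    · rintro w ⟨hw, hwU⟩
      have h1 : {y | IsPolychromatic χ (insert y (insert w p.stem) : Finset ℚ)}ᶜ ∈ U :=
        Ultrafilter.compl_mem_iff_notMem.2 hwU
      have h2 : {y | ∃ a ∈ p.stem, Conflict χ w y w a}ᶜ ∈ U :=
        Ultrafilter.compl_mem_iff_notMem.2 fun h =>
          hU _ h (finiteCBRank_of_finite (finite_conflict_self hχ p.stem w))
      filter_upwards [h1, h2] with y hy1 hy2
      refine ⟨?_, hw, fun a ha hc => hy2 ⟨a, ha, hc⟩⟩
      rw [Finset.insert_comm]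
      exact hy1
    · filter_upwards [p.room] with y hy using encard_obstruction_le hχ le_rfl hy
  · obtain ⟨N, hN⟩ := exists_encard_not_fulfillable_le hχ φ.2.1 φ.2.2 p.stem.card
    exact Set.finite_of_encard_le_coe (hN _ _ le_rfl (p.fulfillable φ hφ))

theorem exists_le (p : Condition χ U) {w : ℚ} (hw : w ∉ p.bad) {S : Set ℚ} {k : ℕ}
    (h : Fulfillable χ S k (insert w p.stem) w) :
    ∃ q ≤ p, (w, S, k) ∈ q.promises := by
  have hpoly := h.basic.2.2
  simp only [bad, Set.mem_union, Set.mem_ofPred_eq, Set.mem_iUnion, hpoly, true_and, not_or,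
    not_not, not_exists] at hw
  refine ⟨⟨insert w p.stem, insert (w, S, k) p.promises, p.finite_promises.insert _, hpoly, hw.1,
    ?_⟩, ⟨Finset.subset_insert _ _, Set.subset_insert _ _⟩, Set.mem_insert _ _⟩
  rintro φ (rfl | hφ)
  · exact h
  · exact hw.2 φ hφ

end Condition

/-- The conditions that promise rank `k` to some point, with respect to `S`. -/
def rankDense (χ : Set.powersetCard ℚ 2 → C) (U : Ultrafilter ℚ) (S : Set ℚ) (k : ℕ) :
    Set (Condition χ U) :=
  {p | ∃ z, (z, S, k) ∈ p.promises}

theorem isCoinitial_rankDense (hχ : IsBoundedColoring 2 χ) (hU : ∀ A ∈ U, A ∉ finiteCBRank)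
    {S : Set ℚ} (hS : S ∈ U) (k : ℕ) : IsCoinitial (rankDense χ U S k) := by
  intro p
  obtain ⟨n, hn⟩ := exists_fulfillable hχ S k p.stem.card
  have hbad : p.badᶜ ∈ U := Ultrafilter.compl_mem_iff_notMem.2 fun h =>
    hU _ h (finiteCBRank_of_finite (p.finite_bad hχ hU))
  have hT := hU _ (inter_mem hS (inter_mem p.room hbad))
  rw [mem_finiteCBRank_iff, not_exists] at hT
  obtain ⟨z, hz, hzf⟩ := hn p.stem le_rfl _ (fun _ h => h.1) (fun _ h => h.2.1)
    (Set.nonempty_iff_ne_empty.2 (hT n))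
  obtain ⟨q, hqp, hq⟩ := p.exists_le hz.2.2 hzf
  exact ⟨q, ⟨z, hq⟩, hqp⟩

/-- The conditions that make a step towards the promise `(z, S, k + 1)`, or exclude it. -/
def stepDense (χ : Set.powersetCard ℚ 2 → C) (U : Ultrafilter ℚ) (S : Set ℚ) (k : ℕ) (z : ℚ)
    (V : Set ℚ) : Set (Condition χ U) :=
  {p | (∃ w ∈ V, w ≠ z ∧ (w, S, k) ∈ p.promises) ∨ ∀ q ≤ p, (z, S, k + 1) ∉ q.promises}

theorem isCoinitial_stepDense (hχ : IsBoundedColoring 2 χ) (hU : ∀ A ∈ U, A ∉ finiteCBRank)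
    (S : Set ℚ) (k : ℕ) (z : ℚ) {V : Set ℚ} (hV : V ∈ 𝓝 z) :
    IsCoinitial (stepDense χ U S k z V) := by
  intro p
  by_cases h : ∀ q ≤ p, (z, S, k + 1) ∉ q.promises
  · exact ⟨p, Or.inr h, le_rfl⟩
  push Not at h
  obtain ⟨q, hqp, hq⟩ := h
  have hacc := accPt_iff_frequently_nhdsNE.1 (q.fulfillable _ hq).2
  have hbad := eventually_notMem_nhdsNE (q.finite_bad hχ hU) z
  have hV' : ∀ᶠ w in 𝓝[≠] z, w ∈ V := nhdsWithin_le_nhds hV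
  have hne : ∀ᶠ w in 𝓝[≠] z, w ≠ z := eventually_mem_nhdsWithin
  obtain ⟨w, hw, ⟨hwb, hwV⟩, hwz⟩ := (hacc.and_eventually ((hbad.and hV').and hne)).exists
  obtain ⟨r, hrq, hr⟩ := q.exists_le hwb hw
  exact ⟨r, Or.inl ⟨w, hwV, hwz, hr⟩, hrq.trans hqp⟩

theorem mem_cbLevel_of_generic {S : Set ℚ} {G : Order.PFilter (Condition χ U)}
    (hG : ∀ (k : ℕ) (z : ℚ) (n : ℕ),
      ((G : Set (Condition χ U)) ∩ stepDense χ U S k z (Metric.ball z (1 / (n + 1)))).Nonempty)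
    (k : ℕ) : ∀ z : ℚ, (∃ p ∈ G, (z, S, k) ∈ p.promises) →
      z ∈ cbLevel ({x | ∃ p ∈ G, x ∈ p.stem} ∩ S) k := by
  induction k with
  | zero => exact fun z ⟨p, hp, hz⟩ =>
      ⟨⟨p, hp, (p.fulfillable _ hz).basic.2.1⟩, (p.fulfillable _ hz).basic.1⟩
  | succ k ih =>
    rintro z ⟨p, hp, hz⟩
    refine ⟨⟨⟨p, hp, (p.fulfillable _ hz).basic.2.1⟩, (p.fulfillable _ hz).basic.1⟩, ?_⟩
    rw [accPt_iff_nhds]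
    intro V hV
    obtain ⟨n, -, hn⟩ := Metric.nhds_basis_ball_inv_nat_succ.mem_iff.1 hV
    obtain ⟨q, hqG, hq⟩ := hG k z n
    rcases hq with ⟨w, hwV, hwz, hw⟩ | hq
    · exact ⟨w, ⟨hn hwV, ih w ⟨q, hqG, hw⟩⟩, hwz⟩
    -- A common extension with `p` still carries the promise for `z`, so `q` cannot have excluded
    -- it.
    · obtain ⟨r, -, hrp, hrq⟩ := G.directed p hp q hqG
      exact absurd (hrp.2 hz) (hq r hrq)

/-- The set added by a sufficiently generic filter is polychromatic and of infinite rank in every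
member of `𝒮`. -/
theorem MartinsAxiom.exists_isPolychromatic (hMA : MartinsAxiom) (hχ : IsBoundedColoring 2 χ)
    (hU : ∀ A ∈ U, A ∉ finiteCBRank) {𝒮 : Set (Set ℚ)} (h𝒮 : #𝒮 < 𝔠) (h𝒮U : ∀ S ∈ 𝒮, S ∈ U) :
    ∃ B : Set ℚ, IsPolychromatic χ B ∧ ∀ S ∈ 𝒮, B ∩ S ∉ finiteCBRank := by
  let D₁ : 𝒮 × ℕ → Set (Condition χ U) := fun i => rankDense χ U i.1 i.2
  let D₂ : 𝒮 × ℕ × ℚ × ℕ → Set (Condition χ U) := fun i =>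
    stepDense χ U i.1 i.2.1 i.2.2.1 (Metric.ball i.2.2.1 (1 / (i.2.2.2 + 1)))
  have hcard : #(range D₁ ∪ range D₂ : Set (Set (Condition χ U))) < 𝔠 := by
    have hmul : ∀ (β : Type) [Countable β], #(𝒮 × β) < 𝔠 := fun β _ => by
      rw [Cardinal.mk_prod, Cardinal.lift_id, Cardinal.lift_id]
      exact Cardinal.mul_lt_of_lt Cardinal.aleph0_le_continuum h𝒮
        ((Cardinal.mk_le_aleph0).trans_lt Cardinal.aleph0_lt_continuum)
    exact (Cardinal.mk_union_le _ _).trans_lt (Cardinal.add_lt_of_lt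
      Cardinal.aleph0_le_continuum (Cardinal.mk_range_le.trans_lt (hmul ℕ))
      (Cardinal.mk_range_le.trans_lt (hmul (ℕ × ℚ × ℕ))))
  obtain ⟨G, hG⟩ := hMA (Condition χ U) countableChainCondition_condition _ hcard (by
    rintro D (⟨⟨S, k⟩, rfl⟩ | ⟨⟨S, k, z, n⟩, rfl⟩)
    · exact isCoinitial_rankDense hχ hU (h𝒮U S S.2) k
    · exact isCoinitial_stepDense hχ hU S k z (Metric.ball_mem_nhds z (by positivity)))
  refine ⟨{x | ∃ p ∈ G, x ∈ p.stem}, ?_, fun S hS => ?_⟩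
  · rw [isPolychromatic_iff]
    rintro a ⟨p, hp, ha⟩ b ⟨q, hq, hb⟩ c ⟨p', hp', hc⟩ d ⟨q', hq', hd⟩
    obtain ⟨r, hr, hrp, hrq⟩ := G.directed p hp q hq
    obtain ⟨r', hr', hrp', hrq'⟩ := G.directed p' hp' q' hq'
    obtain ⟨s, -, hsr, hsr'⟩ := G.directed r hr r' hr'
    exact isPolychromatic_iff.1 s.poly a (hsr.1 (hrp.1 ha)) b (hsr.1 (hrq.1 hb))
      c (hsr'.1 (hrp'.1 hc)) d (hsr'.1 (hrq'.1 hd))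
  · rw [mem_finiteCBRank_iff, not_exists]
    intro k hk
    obtain ⟨p, hp, z, hz⟩ := hG _ (Or.inl ⟨(⟨S, hS⟩, k), rfl⟩)
    have := mem_cbLevel_of_generic (S := S)
      (fun k z n => hG _ (Or.inr ⟨(⟨S, hS⟩, k, z, n), rfl⟩)) k z ⟨p, hp, hz⟩
    exact (hk ▸ this : z ∈ (∅ : Set ℚ))

end Forcing

/-! ### Transfinite construction of the ultrafilter -/

theorem MartinsAxiom.exists_insert_isPositiveFamily (hMA : MartinsAxiom) {C : Type*}
    {χ : Set.powersetCard ℚ 2 → C} (hχ : IsBoundedColoring 2 χ) {𝒜 : Set (Set ℚ)}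
    (h𝒜 : IsPositiveFamily 𝒜) (hcard : #𝒜 < 𝔠) :
    ∃ B : Set ℚ, IsPolychromatic χ B ∧ IsPositiveFamily (insert B 𝒜) := by
  obtain ⟨U, h𝒜U, hU⟩ := h𝒜.exists_ultrafilter
  -- Lists index all finite intersections while keeping their number below `𝔠`.
  let f : List 𝒜 → Set ℚ := fun l => ⋂₀ {A | ∃ a ∈ l, a.1 = A}
  have hf : ∀ l, f l ∈ U := fun l => by
    refine (sInter_mem ?_).2 ?_
    · exact (l.finite_toSet.image Subtype.val)
    · rintro A ⟨a, -, rfl⟩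
      exact h𝒜U a a.2
  have hlt : #(range f) < 𝔠 := Cardinal.mk_range_le.trans_lt
    ((Cardinal.mk_list_le_max _).trans_lt (max_lt Cardinal.aleph0_lt_continuum hcard))
  obtain ⟨B, hB, hBf⟩ := hMA.exists_isPolychromatic hχ hU hlt (by
    rintro _ ⟨l, rfl⟩
    exact hf l)
  refine ⟨B, hB, fun t ht hfin hI => ?_⟩
  have hfin' : {a : 𝒜 | a.1 ∈ t}.Finite := hfin.preimage Subtype.val_injective.injOn
  refine hBf (f hfin'.toFinset.toList) ⟨_, rfl⟩ (finiteCBRank_mono ?_ hI)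
  rintro x ⟨hxB, hx⟩ A hA
  rcases ht hA with rfl | hA'
  · exact hxB
  · exact hx A ⟨⟨A, hA'⟩, by simpa using hA, rfl⟩

/-- Transfinite recursion: positive families can be enlarged `𝔠` many times. -/
theorem exists_isPositiveFamily_range {ι : Type} (hι : #ι ≤ 𝔠) {P : ι → Set ℚ → Prop}
    (hP : ∀ (i : ι) (𝒜 : Set (Set ℚ)), IsPositiveFamily 𝒜 → #𝒜 < 𝔠 →
      ∃ B, P i B ∧ IsPositiveFamily (insert B 𝒜)) :
    ∃ B : ι → Set ℚ, (∀ i, P i (B i)) ∧ IsPositiveFamily (range B) := by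
  choose! f hfP hf using hP
  -- A well-order of least possible type makes every proper initial segment smaller than `𝔠`.
  obtain ⟨_, _, hord⟩ := Cardinal.exists_ord_eq_type_lt ι
  let B : ι → Set ℚ :=
    wellFounded_lt.fix fun i prev => f i {A | ∃ (j : ι) (h : j < i), prev j h = A}
  have hB : ∀ i, B i = f i (B '' Iio i) := fun i => by
    have h : B '' Iio i = {A | ∃ (j : ι) (_ : j < i), B j = A} := by
      ext
      simp
    rw [h]
    exact wellFounded_lt.fix_eq _ i
  have hcard : ∀ i, #(B '' Iio i) < 𝔠 := fun i =>
    Cardinal.mk_image_le.trans_lt ((Cardinal.mk_Iio_lt i hord).trans_le hι)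
  have hlim : ∀ s : Set ι, (∀ i ∈ s, IsPositiveFamily (B '' Iic i)) →
      IsPositiveFamily (B '' s) := by
    intro s hs t ht hfin
    obtain ⟨u, hus, rfl⟩ := Set.subset_image_iff.1 ht
    rcases u.eq_empty_or_nonempty with rfl | hne
    · simpa using univ_notMem_finiteCBRank
    -- `B` need not be injective, so one index is chosen per set; the finitely many indices then
    -- have a maximum.
    obtain ⟨v, hvu, hv⟩ := Set.SurjOn.exists_bijOn_subset (Set.surjOn_image B u)
    have hvfin : v.Finite := hv.finite_iff_finite.2 hfin
    rw [← hv.image_eq]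
    have hvne : v.Nonempty := by
      rw [← Set.image_nonempty (f := B), hv.image_eq]
      exact hne.image B
    obtain ⟨i, hi, hmax⟩ := Set.exists_max_image v id hvfin hvne
    exact hs i (hus (hvu hi)) _ (image_mono fun j hj => hmax j hj) (hvfin.image B)
  have hstep : ∀ i, IsPositiveFamily (B '' Iio i) → IsPositiveFamily (B '' Iic i) := by
    intro i h
    rw [← Iio_insert, image_insert_eq, hB i]
    exact hf i _ h (hcard i)
  have hpos : ∀ i, IsPositiveFamily (B '' Iio i) := fun i => by
    induction i using WellFoundedLT.induction with
    | _ i ih => exact hlim _ fun j hj => hstep j (ih j hj)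
  refine ⟨B, fun i => ?_, ?_⟩
  · rw [hB i]
    exact hfP i _ (hpos i) (hcard i)
  · rw [← image_univ]
    exact hlim _ fun i _ => hstep i (hpos i)

theorem MartinsAxiom.exists_isRainbowRamsey (hMA : MartinsAxiom) :
    ∃ U : Ultrafilter ℕ, IsRainbowRamsey U ∧ ¬ IsDiscreteUltrafilter U := by
  obtain ⟨e⟩ : Nonempty (ℕ ≃ ℚ) := nonempty_equiv_of_countable
  have hι : #{χ : Set.powersetCard ℕ 2 → ℕ // IsBoundedColoring 2 χ} ≤ 𝔠 := by
    refine (Cardinal.mk_subtype_le _).trans ?_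
    rw [← Cardinal.power_def, Cardinal.mk_nat, ← Cardinal.aleph0_power_aleph0]
    exact Cardinal.power_le_power_left Cardinal.aleph0_ne_zero Cardinal.mk_le_aleph0
  obtain ⟨B, hB, hpos⟩ := exists_isPositiveFamily_range hι
    (P := fun χ B => IsPolychromatic χ.1 (e ⁻¹' B)) (by
      rintro ⟨χ, hχ⟩ 𝒜 h𝒜 hcard
      let g : Set.powersetCard ℚ 2 → Set.powersetCard ℕ 2 :=
        Set.powersetCard.map 2 e.symm.toEmbedding
      have hginj : Function.Injective g := fun s t hst =>
        Subtype.ext (Finset.map_injective e.symm.toEmbedding (congrArg Subtype.val hst))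
      obtain ⟨B, hBχ, hB⟩ := hMA.exists_insert_isPositiveFamily (χ := χ ∘ g) (fun c => by
        rw [Set.preimage_comp, ← hginj.encard_image]
        exact (Set.encard_le_encard (image_preimage_subset g _)).trans (hχ c)) h𝒜 hcard
      refine ⟨B, ?_, hB⟩
      intro s hs t ht hst
      let g' : Set.powersetCard ℕ 2 → Set.powersetCard ℚ 2 :=
        Set.powersetCard.map 2 e.toEmbedding
      have hg : ∀ s, g (g' s) = s := fun s => Subtype.ext (by
        simp [g, g', Set.powersetCard.val_map, Finset.map_map])
      have hmem : ∀ s : Set.powersetCard ℕ 2, (s.1 : Set ℕ) ⊆ e ⁻¹' B →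
          ((g' s).1 : Set ℚ) ⊆ B := fun s hs => by
        simpa [g', Set.powersetCard.val_map] using hs
      have := hBχ (hmem s hs) (hmem t ht) (by simpa [hg] using hst)
      rw [← hg s, this, hg])
  obtain ⟨U, hBU, hU⟩ := hpos.exists_ultrafilter
  have hmem : ∀ A : Set ℕ, A ∈ U.map e.symm ↔ e '' A ∈ U := fun A => by
    rw [Ultrafilter.mem_map, e.image_eq_preimage_symm]
  refine ⟨U.map e.symm, ⟨fun x hx => ?_, fun χ hχ => ?_⟩, fun h => ?_⟩
  · have : ({x} : Set ℕ) ∈ U.map e.symm := hx ▸ Ultrafilter.mem_pure.2 rfl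
    exact hU _ ((hmem _).1 this) (finiteCBRank_of_finite (by simp))
  · refine ⟨e ⁻¹' B ⟨χ, hχ⟩, (hmem _).2 ?_, hB ⟨χ, hχ⟩⟩
    rw [e.image_preimage]
    exact hBU _ ⟨_, rfl⟩
  -- The bijection `e` itself refutes discreteness.
  · obtain ⟨A, hA, hd⟩ := h.2 e
    exact hU _ ((hmem A).1 hA) (finiteCBRank_of_isDiscrete hd)

end RainbowRamsey

theorem mainTheorem5 (hMA : RainbowRamsey.MartinsAxiom) :
    (∀ (S : FilterBasis ℚ), S.sets ∩ RainbowRamsey.finiteCBRank = ∅ →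
      Cardinal.mk S.sets < Cardinal.continuum →
      ∀ (C : Type*) (χ : Set.powersetCard ℚ 2 → C), RainbowRamsey.IsBoundedColoring 2 χ →
        ∃ B : Set ℚ, RainbowRamsey.IsPolychromatic χ B ∧
          ∀ A ∈ S.sets, B ∩ A ∉ RainbowRamsey.finiteCBRank) ∧
    (∃ U : Ultrafilter ℕ, RainbowRamsey.IsRainbowRamsey U ∧
      ¬ RainbowRamsey.IsDiscreteUltrafilter U) := by
  refine ⟨fun S hS hcard C χ hχ => ?_, hMA.exists_isRainbowRamsey⟩
  obtain ⟨U, hSU, hU⟩ := (RainbowRamsey.isPositiveFamily_filterBasis hS).exists_ultrafilter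
  exact hMA.exists_isPolychromatic hχ hU hcard hSU
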